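/- Setting. Let $\mathcal X\subset\mathbb R^d$ be convex and compact, $q\in(0,1)$, $\sigma>0$, and fix $\beta\in\mathbb R^d$ with $\|\beta\|=1$. An agent has a type $(Z,c)$, consisting of raw covariates $Z\in\mathcal X$ and a cost function $c:\mathbb R^d\to\mathbb R$, and a noise vector $\varepsilon\sim N(0,\sigma^2 I_d)$ independent of the type; $F$ denotes the joint law of $((Z,c),\varepsilon)$. An agent facing the threshold $s\in\mathbb R$ has the best response $$x^*(\beta,s)\in\operatorname*{argmax}_{x\in\mathcal X}\ \mathbb E_\varepsilon\big[-c(x-Z)+\mathbf 1\{\beta^\top(x+\varepsilon)>s\}\big]$$ and obtains the score $\beta^\top(x^*(\beta,s)+\varepsilon)$. Let $P(\beta,s)$ be the distribution of this score when the agent is drawn from $F$, let $P^n(\beta,s)$ be the empirical distribution of the scores of $n$ agents drawn i.i.d. from $F$, and let $q(G)=\inf\{r: G(r)\ge q\}$ denote the $q$-th quantile of a distribution function $G$. For each $n$, starting from a real (possibly random) initial threshold $\hat S_n^0$ independent of all the sampled agents, define $\hat S_n^{t}=q(P^{n}(\beta,\hat S_n^{t-1}))$ for $t=1,2,\dots$,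 where $n$ new agents are sampled i.i.d. from $F$, independently over time, at every time step $t$. Assumptions. (1) The law of $(Z,c)$ has finite support. (2) For every type $i=(Z_i,c_i)$ in the support, $c_i$ is twice continuously differentiable, $\alpha_i$-strongly convex for some $\alpha_i>0$, and minimized at the origin. (3) For every type in the support and every $s\in\mathbb R$, $x^*(\beta,s)\in\operatorname{Int}(\mathcal X)$. (4) $\sigma^2>\dfrac{2}{\alpha_*\sqrt{2\pi e}}$, where $\alpha_*=\inf_i\alpha_i$ over the types in the support. Claim. The map $s\mapsto q(P(\beta,s))$ has a unique fixed point $s(\beta)\in\mathbb R$ (the mean-field equilibrium threshold), and for every sequence of times $t_n\in\mathbb N$ with $t_n\to\infty$ and $t_n=o(e^n)$ as $n\to\infty$ (in particular if $t_n\uparrow\infty$ subexponentially in $n$), $\hat S_n^{t_n}\to s(\beta)$ in probability as $n\to\infty$. -/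

import Mathlib

open MeasureTheory ProbabilityTheory Filter Topology
open scoped RealInnerProductSpace ENNReal

namespace StrategicThreshold

/-- Covariate space `ℝᵈ` with its Euclidean norm. -/
abbrev Cov (d : ℕ) : Type := EuclideanSpace ℝ (Fin d)

/-- An agent type `(Z, c)`: raw covariates and the cost function for deviating from them. -/
@[ext]
structure AgentType (d : ℕ) where
  raw : Cov d
  cost : Cov d → ℝ

/-- Types are drawn from finitely supported laws, so they carry the discrete σ-algebra. -/
instance (d : ℕ) : MeasurableSpace (AgentType d) := ⊤

/-- The unobservables `((Z, c), ε)` of an agent that matter for the thresholds: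
the type and the noise. -/
abbrev Agent (d : ℕ) : Type := AgentType d × Cov d

variable {d : ℕ}

/-- The noise law `N(0, σ² I_d)`. -/
noncomputable def noiseLaw (d : ℕ) (σ : ℝ) : Measure (Cov d) :=
  multivariateGaussian 0 (σ ^ 2 • (1 : Matrix (Fin d) (Fin d) ℝ))

/-- The law `F` of `((Z, c), ε)` when the type has law `p` and the noise is independent of it. -/
noncomputable def population (p : PMF (AgentType d)) (σ : ℝ) : Measure (Agent d) :=
  p.toMeasure.prod (noiseLaw d σ)

/-- The threshold rule `π(x; β, s) = 𝟙(βᵀx > s)`. -/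
noncomputable def policy (β : Cov d) (s : ℝ) (x : Cov d) : ℝ :=
  if s < ⟪β, x⟫ then 1 else 0

/-- The utility `-c(x - Z) + π(x + ε; β, s)` of an agent of type `θ` with noise `ε`. -/
noncomputable def utility (θ : AgentType d) (β : Cov d) (s : ℝ) (x ε : Cov d) : ℝ :=
  -θ.cost (x - θ.raw) + policy β s (x + ε)

/-- The utility averaged over the noise. -/
noncomputable def expectedUtility (σ : ℝ) (θ : AgentType d) (β : Cov d) (s : ℝ) (x : Cov d) : ℝ :=
  ∫ ε, utility θ β s x ε ∂(noiseLaw d σ)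

/-- `x` maximizes the expected utility over the covariate set `X`. -/
def IsBestResponse (X : Set (Cov d)) (σ : ℝ) (θ : AgentType d) (β : Cov d) (s : ℝ)
    (x : Cov d) : Prop :=
  x ∈ X ∧ IsMaxOn (expectedUtility σ θ β s) X x

/-- The best response `x*(β, s)`: the maximizer over `X` of the expected utility
(an arbitrary maximizer if there are several). -/
noncomputable def bestResponse (X : Set (Cov d)) (σ : ℝ) (θ : AgentType d) (β : Cov d) (s : ℝ) :
    Cov d :=
  Classical.epsilon (IsBestResponse X σ θ β s)

/-- The score `βᵀ(x*(β, s) + ε)` of an agent who responds to criterion `β` and threshold `s`. -/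
noncomputable def score (X : Set (Cov d)) (σ : ℝ) (β : Cov d) (s : ℝ) (a : Agent d) : ℝ :=
  ⟪β, bestResponse X σ a.1 β s + a.2⟫

/-- The `q`-th quantile of a cumulative distribution function. -/
noncomputable def quantile (G : ℝ → ℝ) (q : ℝ) : ℝ :=
  sInf {r : ℝ | q ≤ G r}

/-- The mean-field score distribution `P(β, s)`, as a cumulative distribution function. -/
noncomputable def scoreCDF (X : Set (Cov d)) (σ : ℝ) (p : PMF (AgentType d)) (β : Cov d) (s : ℝ) :
    ℝ → ℝ :=
  cdf ((population p σ).map (score X σ β s))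

/-- The mean-field threshold operator `s ↦ q(P(β, s))`. -/
noncomputable def meanFieldOp (X : Set (Cov d)) (σ : ℝ) (p : PMF (AgentType d)) (q : ℝ)
    (β : Cov d) (s : ℝ) : ℝ :=
  quantile (scoreCDF X σ p β s) q

/-- The cumulative distribution function of the empirical distribution of `x₁, …, xₙ`. -/
noncomputable def empiricalCDF {n : ℕ} (x : Fin n → ℝ) (r : ℝ) : ℝ :=
  (Finset.univ.filter fun i => x i ≤ r).card / (n : ℝ)

/-- The finite-sample threshold operator `s ↦ q(Pⁿ(β, s))` for a given sample of `n` agents. -/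
noncomputable def empiricalOp (X : Set (Cov d)) (σ q : ℝ) (β : Cov d) {n : ℕ}
    (a : Fin n → Agent d) (s : ℝ) : ℝ :=
  quantile (empiricalCDF fun i => score X σ β s (a i)) q

/-- The thresholds `Ŝₙ⁰, Ŝₙ¹, Ŝₙ², …` obtained from the initial threshold `s₀` when `a t` are the
`n` new agents considered at time step `t + 1`. -/
noncomputable def thresholdProcess (X : Set (Cov d)) (σ q : ℝ) (β : Cov d) {n : ℕ}
    (a : ℕ → Fin n → Agent d) (s₀ : ℝ) : ℕ → ℝ
  | 0 => s₀
  | t + 1 => empiricalOp X σ q β (a t) (thresholdProcess X σ q β a s₀ t)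

/-- The cost function is `C²`, `α`-strongly convex with `α > 0`, and minimized at the origin. -/
structure IsRegularCost (c : Cov d → ℝ) (α : ℝ) : Prop where
  contDiff : ContDiff ℝ 2 c
  pos : 0 < α
  strongConvex : StrongConvexOn Set.univ α c
  minimized : ∀ y, c 0 ≤ c y

/-- `α_* = inf α_i` over the types in the support of the population. -/
noncomputable def alphaStar (p : PMF (AgentType d)) (α : AgentType d → ℝ) : ℝ :=
  sInf (α '' p.support)

end StrategicThreshold

/-!
The proof is a pathwise contraction argument.

Write `w_θ(s) = ⟪β, x*(β, s)⟫` for the response score of an agent of type `θ`. The noise only enters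
the expected utility through `⟪β, ε⟫`, a centred Gaussian of variance `σ²`, so the agent maximizes
`-c(x - Z) + ℙ(⟪β, ε⟫ > s - ⟪β, x⟫)` (`expectedUtility_eq`). Comparing a maximizer with the points of
the segment towards another covariate gives a variational inequality with a quadratic gain from
strong convexity (`IsBestResponse.variational`). Adding the inequalities for two thresholds and
using that the Gaussian density is Lipschitz with constant `L = 1 / (σ² √(2πe))` gives
`|w_θ(s) - w_θ(s')| ≤ L / (α - L) * |s - s'|` (`IsBestResponse.abs_inner_sub_le`). The noise
condition says `α_* > 2L`, hence `k = L / (α_* - L) < 1` is a common contraction rate.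

Scores at two thresholds differ by `w_θ(s) - w_θ(s')` for one and the same agent, and quantiles are
monotone and commute with shifts. Therefore both the mean-field operator and, for almost every
sample, the empirical operators are `k`-Lipschitz (`abs_meanFieldOp_sub_le`,
`abs_empiricalOp_sub_le`). The first fact gives the unique fixed point `c`. The second one gives
`|Ŝᵗ⁺¹ - c| ≤ k |Ŝᵗ - c| + eₜ`, where `eₜ` is the error of the empirical operator of step `t` at the
single nonrandom threshold `c`; no conditioning on the past is needed. Hoeffding's inequality bounds
`ℙ(eₜ > δ)` uniformly in `t` (`exists_measureReal_quantile_le`). Since `X` is bounded, one good step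
brings the threshold within a fixed distance of `c` from anywhere, so a fixed number of good steps
before time `t n` suffices (`tendstoInMeasure_thresholdProcess`).
-/

namespace StrategicThreshold

open scoped NNReal

/-! ### Quantiles -/

/-- The level set `{r | q ≤ G r}` is nonempty and bounded below, so that the infimum in
`quantile G q` is a genuine one. -/
def HasQuantile (G : ℝ → ℝ) (q : ℝ) : Prop :=
  {r : ℝ | q ≤ G r}.Nonempty ∧ BddBelow {r : ℝ | q ≤ G r}

lemma quantile_le_add {F G : ℝ → ℝ} {q δ : ℝ} (hF : HasQuantile F q) (hG : HasQuantile G q)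
    (h : ∀ r, F r ≤ G (r + δ)) : quantile G q ≤ quantile F q + δ := by
  rw [← sub_le_iff_le_add]
  refine le_csInf hF.1 fun r hr => ?_
  rw [sub_le_iff_le_add]
  exact csInf_le hG.2 (le_trans hr (h r))

lemma abs_quantile_sub_le {F G : ℝ → ℝ} {q δ : ℝ} (hF : HasQuantile F q) (hG : HasQuantile G q)
    (hFG : ∀ r, F r ≤ G (r + δ)) (hGF : ∀ r, G r ≤ F (r + δ)) :
    |quantile F q - quantile G q| ≤ δ := by
  rw [abs_sub_le_iff]
  constructor
  · linarith [quantile_le_add hG hF hGF]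
  · linarith [quantile_le_add hF hG hFG]

lemma hasQuantile_cdf (ν : Measure ℝ) {q : ℝ} (hq0 : 0 < q) (hq1 : q < 1) :
    HasQuantile (cdf ν) q := by
  constructor
  · obtain ⟨r, hr⟩ := ((tendsto_cdf_atTop ν).eventually (lt_mem_nhds hq1)).exists
    exact ⟨r, hr.le⟩
  · obtain ⟨r, hr⟩ := ((tendsto_cdf_atBot ν).eventually (gt_mem_nhds hq0)).exists
    refine ⟨r, fun x hx => ?_⟩
    by_contra! hlt
    exact absurd hr (not_lt.2 (le_trans hx (monotone_cdf ν hlt.le)))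

lemma empiricalCDF_mono {n : ℕ} (x : Fin n → ℝ) : Monotone (empiricalCDF x) := by
  intro a b hab
  unfold empiricalCDF
  gcongr

lemma empiricalCDF_le_of_le_add {n : ℕ} {x y : Fin n → ℝ} {δ : ℝ} (h : ∀ i, y i ≤ x i + δ)
    (r : ℝ) : empiricalCDF x r ≤ empiricalCDF y (r + δ) := by
  unfold empiricalCDF
  refine div_le_div_of_nonneg_right ?_ n.cast_nonneg
  exact_mod_cast Finset.card_le_card
    (Finset.monotone_filter_right _ fun i _ hi => (h i).trans (add_le_add_left hi δ))

lemma hasQuantile_empiricalCDF {n : ℕ} (hn : 0 < n) (x : Fin n → ℝ) {q : ℝ} (hq0 : 0 < q)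
    (hq1 : q < 1) : HasQuantile (empiricalCDF x) q := by
  have hn' : (0 : ℝ) < n := by exact_mod_cast hn
  obtain ⟨M, hM⟩ := (Set.finite_range x).bddAbove
  obtain ⟨m, hm⟩ := (Set.finite_range x).bddBelow
  constructor
  · refine ⟨M, ?_⟩
    have : (Finset.univ.filter fun i => x i ≤ M) = Finset.univ :=
      Finset.filter_true_of_mem fun i _ => hM ⟨i, rfl⟩
    simp only [Set.mem_ofPred_eq, empiricalCDF, this, Finset.card_univ, Fintype.card_fin]
    rw [div_self hn'.ne']
    exact hq1.le
  · refine ⟨m, fun r hr => ?_⟩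
    by_contra! hlt
    have : (Finset.univ.filter fun i => x i ≤ r) = ∅ :=
      Finset.filter_false_of_mem fun i _ => not_le.2 (hlt.trans_le (hm ⟨i, rfl⟩))
    simp only [Set.mem_ofPred_eq, empiricalCDF, this, Finset.card_empty, Nat.cast_zero,
      zero_div] at hr
    linarith

/-! ### The centred Gaussian density and its tail -/

lemma hasDerivAt_gaussianPDFReal (v : ℝ≥0) (x : ℝ) :
    HasDerivAt (gaussianPDFReal 0 v) (-(x / v) * gaussianPDFReal 0 v x) x := by
  rw [gaussianPDFReal_def]
  have h : HasDerivAt (fun y : ℝ => -(y - 0) ^ 2 / (2 * (v : ℝ))) (-(x / v)) x := by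
    simp only [sub_zero]
    refine ((hasDerivAt_pow 2 x).fun_neg.div_const (2 * (v : ℝ))).congr_deriv ?_
    rw [Nat.cast_ofNat, Nat.add_one_sub_one, pow_one, neg_div, mul_div_mul_left _ _ two_ne_zero]
  exact (h.exp.const_mul (√(2 * Real.pi * v))⁻¹).congr_deriv (by ring)

/-- The largest slope of the Gaussian density of variance `v`, attained one standard deviation
away from the mean. -/
noncomputable def gaussianSlope (v : ℝ≥0) : ℝ := 1 / (v * √(2 * Real.pi * Real.exp 1))

lemma gaussianSlope_pos {v : ℝ≥0} (hv : v ≠ 0) : 0 < gaussianSlope v := by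
  have : (0 : ℝ) < v := by exact_mod_cast pos_iff_ne_zero.2 hv
  unfold gaussianSlope
  positivity

lemma abs_deriv_gaussianPDFReal_le {v : ℝ≥0} (hv : v ≠ 0) (x : ℝ) :
    |-(x / v) * gaussianPDFReal 0 v x| ≤ gaussianSlope v := by
  have hv' : (0 : ℝ) < v := by exact_mod_cast pos_iff_ne_zero.2 hv
  set τ : ℝ := √v with hτ
  have hτ0 : 0 < τ := Real.sqrt_pos.2 hv'
  have hvτ : (v : ℝ) = τ ^ 2 := (Real.sq_sqrt hv'.le).symm
  -- with `y = |x| / √v` the claim becomes `y * exp (-y² / 2) ≤ exp (-1 / 2)`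
  have key : |x| / τ * Real.exp (-x ^ 2 / (2 * v)) ≤ Real.exp (-1 / 2) := by
    have h1 : |x| / τ ≤ Real.exp ((x ^ 2 / v - 1) / 2) := by
      have h2 := Real.add_one_le_exp ((x ^ 2 / v - 1) / 2)
      have h3 : x ^ 2 / v = (|x| / τ) ^ 2 := by rw [div_pow, sq_abs, hvτ]
      rw [h3] at h2 ⊢
      nlinarith [sq_nonneg (|x| / τ - 1)]
    calc |x| / τ * Real.exp (-x ^ 2 / (2 * v))
        ≤ Real.exp ((x ^ 2 / v - 1) / 2) * Real.exp (-x ^ 2 / (2 * v)) := by gcongr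
      _ = Real.exp (-1 / 2) := by
        rw [← Real.exp_add]
        congr 1
        field_simp
        ring
  have hs1 : √(2 * Real.pi * v) = √(2 * Real.pi) * τ := Real.sqrt_mul (by positivity) _
  have hs2 : √(2 * Real.pi * Real.exp 1) = √(2 * Real.pi) * Real.exp (1 / 2) := by
    rw [Real.sqrt_mul (by positivity), Real.exp_half]
  have he : Real.exp (-1 / 2) = 1 / Real.exp (1 / 2) := by
    rw [neg_div, Real.exp_neg, inv_eq_one_div]
  rw [abs_mul, abs_neg, abs_div, abs_of_pos hv', abs_of_nonneg (gaussianPDFReal_nonneg _ _ _),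
    gaussianPDFReal, gaussianSlope, hs1, hs2, sub_zero]
  calc |x| / v * ((√(2 * Real.pi) * τ)⁻¹ * Real.exp (-x ^ 2 / (2 * v)))
      = (v * √(2 * Real.pi))⁻¹ * (|x| / τ * Real.exp (-x ^ 2 / (2 * v))) := by
        field_simp
    _ ≤ (v * √(2 * Real.pi))⁻¹ * Real.exp (-1 / 2) := by gcongr
    _ = 1 / (v * (√(2 * Real.pi) * Real.exp (1 / 2))) := by
        rw [he, mul_one_div, ← mul_assoc, inv_eq_one_div, div_div]

lemma abs_gaussianPDFReal_sub_le {v : ℝ≥0} (hv : v ≠ 0) (a b : ℝ) :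
    |gaussianPDFReal 0 v a - gaussianPDFReal 0 v b| ≤ gaussianSlope v * |a - b| := by
  have := Convex.norm_image_sub_le_of_norm_hasDerivWithin_le (s := Set.univ)
    (fun x _ => (hasDerivAt_gaussianPDFReal v x).hasDerivWithinAt)
    (fun x _ => abs_deriv_gaussianPDFReal_le hv x) convex_univ (Set.mem_univ b) (Set.mem_univ a)
  simpa only [Real.norm_eq_abs] using this

/-- The probability that a centred Gaussian of variance `v` exceeds `u`. -/
noncomputable def gaussianTail (v : ℝ≥0) (u : ℝ) : ℝ := (gaussianReal 0 v).real (Set.Ioi u)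

lemma hasDerivAt_gaussianTail {v : ℝ≥0} (hv : v ≠ 0) (u : ℝ) :
    HasDerivAt (gaussianTail v) (-gaussianPDFReal 0 v u) u := by
  have hint := integrable_gaussianPDFReal 0 v
  have heq : gaussianTail v = fun u => (∫ x in Set.Ioi (0 : ℝ), gaussianPDFReal 0 v x)
      - ∫ x in (0 : ℝ)..u, gaussianPDFReal 0 v x := by
    funext u
    rw [gaussianTail, Measure.real, gaussianReal_apply_eq_integral _ hv,
      ENNReal.toReal_ofReal (integral_nonneg (gaussianPDFReal_nonneg _ _)),
      ← intervalIntegral.integral_Ioi_sub_Ioi' hint.integrableOn hint.integrableOn]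
    ring
  rw [heq]
  have hcont : Continuous (gaussianPDFReal 0 v) :=
    continuous_iff_continuousAt.2 fun x => (hasDerivAt_gaussianPDFReal v x).continuousAt
  exact (hcont.integral_hasStrictDerivAt 0 u).hasDerivAt.const_sub _

/-! ### Noise and expected utility -/

variable {d : ℕ}

instance (σ : ℝ) : IsGaussian (noiseLaw d σ) := by
  unfold noiseLaw; infer_instance

instance (σ : ℝ) : IsProbabilityMeasure (noiseLaw d σ) := by
  unfold noiseLaw; infer_instance

instance (p : PMF (AgentType d)) (σ : ℝ) : IsProbabilityMeasure (population p σ) := by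
  unfold population; infer_instance

lemma map_inner_noiseLaw (σ : ℝ) {β : Cov d} (hβ : ‖β‖ = 1) :
    (noiseLaw d σ).map (fun ε => ⟪β, ε⟫) = gaussianReal 0 (σ ^ 2).toNNReal := by
  have hS : (σ ^ 2 • (1 : Matrix (Fin d) (Fin d) ℝ)).PosSemidef :=
    Matrix.PosSemidef.one.smul (sq_nonneg σ)
  have h := IsGaussian.map_eq_gaussianReal (μ := noiseLaw d σ) (innerSL ℝ β)
  have hmean : (noiseLaw d σ)[innerSL ℝ β] = 0 := by
    rw [(innerSL ℝ β).integral_comp_id_comm IsGaussian.integrable_id, noiseLaw,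
      integral_id_multivariateGaussian, map_zero]
  have hvar : Var[innerSL ℝ β; noiseLaw d σ] = σ ^ 2 := by
    have hb : β.ofLp ⬝ᵥ β.ofLp = 1 := by
      have := real_inner_self_eq_norm_sq β
      rw [hβ, EuclideanSpace.inner_eq_star_dotProduct] at this
      simpa using this
    have hcov := covarianceBilin_multivariateGaussian (μ := 0) hS β β
    rw [covarianceBilin_self IsGaussian.memLp_two_id] at hcov
    rw [Matrix.smul_mulVec, Matrix.one_mulVec, dotProduct_smul, hb, smul_eq_mul, mul_one] at hcov
    exact hcov
  rw [hmean, hvar] at h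
  exact h

lemma expectedUtility_eq (σ : ℝ) (θ : AgentType d) {β : Cov d} (hβ : ‖β‖ = 1) (s : ℝ)
    (x : Cov d) : expectedUtility σ θ β s x =
      -θ.cost (x - θ.raw) + gaussianTail (σ ^ 2).toNNReal (s - ⟪β, x⟫) := by
  have hm : Measurable fun ε : Cov d => ⟪β, ε⟫ := by fun_prop
  have hset : MeasurableSet {ε : Cov d | s - ⟪β, x⟫ < ⟪β, ε⟫} := measurableSet_lt (by fun_prop) hm
  have hpol : policy β s ∘ (fun ε => x + ε)
      = Set.indicator {ε : Cov d | s - ⟪β, x⟫ < ⟪β, ε⟫} 1 := by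
    funext ε
    simp only [policy, Function.comp, Set.indicator, Set.mem_ofPred_eq, inner_add_right,
      sub_lt_iff_lt_add', Pi.one_apply]
  have hpol' : ∀ ε, policy β s (x + ε) = _ := fun ε => congrFun hpol ε
  unfold expectedUtility utility
  simp_rw [hpol']
  have hi : Integrable (Set.indicator {ε : Cov d | s - ⟪β, x⟫ < ⟪β, ε⟫} (1 : Cov d → ℝ))
      (noiseLaw d σ) := (integrable_const (1 : ℝ)).indicator hset
  rw [integral_add (integrable_const _) hi, integral_const, integral_indicator_one hset,
    gaussianTail, ← map_inner_noiseLaw σ hβ, map_measureReal_apply hm measurableSet_Ioi]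
  simp
  rfl

/-! ### Sensitivity of the best response -/

lemma isBestResponse_bestResponse {X : Set (Cov d)} (hX : IsCompact X) (hne : X.Nonempty)
    {σ : ℝ} (hσ : 0 < σ) {θ : AgentType d} (hθ : Continuous θ.cost) {β : Cov d} (hβ : ‖β‖ = 1)
    (s : ℝ) : IsBestResponse X σ θ β s (bestResponse X σ θ β s) := by
  have hv : (σ ^ 2).toNNReal ≠ 0 := (Real.toNNReal_pos.2 (by positivity)).ne'
  have htail : Continuous (gaussianTail (σ ^ 2).toNNReal) :=
    continuous_iff_continuousAt.2 fun u => (hasDerivAt_gaussianTail hv u).continuousAt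
  have hc : Continuous (expectedUtility σ θ β s) := by
    rw [funext (expectedUtility_eq σ θ hβ s)]
    fun_prop
  obtain ⟨x, hx, hmax⟩ := hX.exists_isMaxOn hne hc.continuousOn
  exact Classical.epsilon_spec (p := IsBestResponse X σ θ β s) ⟨x, hx, hmax⟩

/-- First-order optimality of a best response along the segment towards another covariate `y`,
with the quadratic gain from strong convexity. -/
lemma IsBestResponse.variational {X : Set (Cov d)} (hX : Convex ℝ X) {σ : ℝ} (hσ : 0 < σ)
    {θ : AgentType d} {α : ℝ} (hθ : StrongConvexOn Set.univ α θ.cost) {β : Cov d}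
    (hβ : ‖β‖ = 1) {s : ℝ} {x y : Cov d} (hx : IsBestResponse X σ θ β s x) (hy : y ∈ X) :
    gaussianPDFReal 0 (σ ^ 2).toNNReal (s - ⟪β, x⟫) * (⟪β, y⟫ - ⟪β, x⟫) + α / 2 * ‖x - y‖ ^ 2
      ≤ θ.cost (y - θ.raw) - θ.cost (x - θ.raw) := by
  have hv : (σ ^ 2).toNNReal ≠ 0 := (Real.toNNReal_pos.2 (by positivity)).ne'
  set v := (σ ^ 2).toNNReal
  set D := ⟪β, y⟫ - ⟪β, x⟫ with hD
  -- slope at `x` of the acceptance probability along the segment from `x` to `y`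
  have hder : HasDerivAt (fun τ : ℝ => gaussianTail v (s - ⟪β, x⟫ - τ * D))
      (gaussianPDFReal 0 v (s - ⟪β, x⟫) * D) 0 := by
    have h1 : HasDerivAt (fun τ : ℝ => s - ⟪β, x⟫ - τ * D) (-(1 * D)) 0 :=
      ((hasDerivAt_id (0 : ℝ)).mul_const D).const_sub _
    have h2 := hasDerivAt_gaussianTail hv (s - ⟪β, x⟫ - 0 * D)
    refine (h2.comp (0 : ℝ) h1).congr_deriv ?_
    rw [zero_mul, sub_zero]
    ring
  have hslope := hder.tendsto_slope_zero_right
  have hlim : Tendsto (fun τ : ℝ => α / 2 * (1 - τ) * ‖x - y‖ ^ 2) (𝓝[>] 0)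
      (𝓝 (α / 2 * (1 - 0) * ‖x - y‖ ^ 2)) := by
    refine Tendsto.mono_left (Continuous.tendsto ?_ 0) nhdsWithin_le_nhds
    fun_prop
  have hsum := hslope.add hlim
  rw [sub_zero, mul_one] at hsum
  refine le_of_tendsto hsum ?_
  filter_upwards [Ioo_mem_nhdsGT (zero_lt_one (α := ℝ))] with τ ⟨hτ0, hτ1⟩
  have hmem : (1 - τ) • x + τ • y ∈ X := hX hx.1 hy (by linarith) hτ0.le (by ring)
  have hopt := hx.2 hmem
  simp only [Set.mem_ofPred_eq, expectedUtility_eq σ θ hβ] at hopt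
  obtain ⟨-, hconv⟩ := hθ
  have hcx := hconv (Set.mem_univ (x - θ.raw)) (Set.mem_univ (y - θ.raw))
    (a := 1 - τ) (b := τ) (by linarith) hτ0.le (by ring)
  have e1 : (1 - τ) • (x - θ.raw) + τ • (y - θ.raw) = (1 - τ) • x + τ • y - θ.raw := by module
  have e2 : x - θ.raw - (y - θ.raw) = x - y := by abel
  have e3 : s - ⟪β, (1 - τ) • x + τ • y⟫ = s - ⟪β, x⟫ - τ * D := by
    rw [inner_add_right, inner_smul_right, inner_smul_right, hD]
    ring
  rw [e1, e2] at hcx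
  rw [e3] at hopt
  simp only [smul_eq_mul] at hcx ⊢
  rw [zero_add, zero_mul, sub_zero, inv_mul_eq_div, ← le_sub_iff_add_le, div_le_iff₀ hτ0]
  linarith

/-- The response score of a strategic agent moves by at most `L / (α - L)` times the change of
the threshold, where `L` is the largest slope of the noise density. -/
lemma IsBestResponse.abs_inner_sub_le {X : Set (Cov d)} (hX : Convex ℝ X) {σ : ℝ} (hσ : 0 < σ)
    {θ : AgentType d} {α : ℝ} (hθ : StrongConvexOn Set.univ α θ.cost)
    (hα : gaussianSlope (σ ^ 2).toNNReal < α) {β : Cov d} (hβ : ‖β‖ = 1) {s s' : ℝ}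
    {x x' : Cov d} (hx : IsBestResponse X σ θ β s x) (hx' : IsBestResponse X σ θ β s' x') :
    |⟪β, x⟫ - ⟪β, x'⟫| ≤
      gaussianSlope (σ ^ 2).toNNReal / (α - gaussianSlope (σ ^ 2).toNNReal) * |s - s'| := by
  have hv : (σ ^ 2).toNNReal ≠ 0 := (Real.toNNReal_pos.2 (by positivity)).ne'
  have hL := gaussianSlope_pos hv
  have h1 := hx.variational hX hσ hθ hβ hx'.1
  have h2 := hx'.variational hX hσ hθ hβ hx.1
  have hlip := abs_gaussianPDFReal_sub_le hv (s - ⟪β, x⟫) (s' - ⟪β, x'⟫)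
  set v := (σ ^ 2).toNNReal
  set L := gaussianSlope v
  set W := ⟪β, x⟫ - ⟪β, x'⟫ with hW
  have hWx : |W| ≤ ‖x - x'‖ := by
    rw [hW, ← inner_sub_right]
    simpa [hβ] using abs_real_inner_le_norm β (x - x')
  have hsq : |W| ^ 2 ≤ ‖x - x'‖ ^ 2 := by gcongr
  have hα0 : 0 < α := hL.trans hα
  have htri : |s - ⟪β, x⟫ - (s' - ⟪β, x'⟫)| ≤ |s - s'| + |W| := by
    rw [show s - ⟪β, x⟫ - (s' - ⟪β, x'⟫) = (s - s') - W by rw [hW]; ring]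
    exact abs_sub _ _
  rw [norm_sub_rev x' x] at h2
  have hprod : α * |W| ^ 2 ≤ L * (|s - s'| + |W|) * |W| := by
    calc α * |W| ^ 2 ≤ α * ‖x - x'‖ ^ 2 := by gcongr
      _ ≤ (gaussianPDFReal 0 v (s - ⟪β, x⟫) - gaussianPDFReal 0 v (s' - ⟪β, x'⟫)) * W := by
        rw [hW]; linarith
      _ ≤ |gaussianPDFReal 0 v (s - ⟪β, x⟫) - gaussianPDFReal 0 v (s' - ⟪β, x'⟫)| * |W| := by
        rw [← abs_mul]; exact le_abs_self _
      _ ≤ L * (|s - s'| + |W|) * |W| := by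
        gcongr
        exact hlip.trans (by gcongr)
  rw [div_mul_eq_mul_div, le_div_iff₀ (by linarith)]
  rcases (abs_nonneg W).eq_or_lt with h0 | h0
  · rw [← h0, zero_mul]; positivity
  · have : α * |W| ≤ L * (|s - s'| + |W|) := by
      refine le_of_mul_le_mul_right ?_ h0
      linarith [sq |W|]
    linarith

/-! ### Scores and threshold operators -/

lemma score_eq (X : Set (Cov d)) (σ : ℝ) (β : Cov d) (s : ℝ) (a : Agent d) :
    score X σ β s a = ⟪β, bestResponse X σ a.1 β s⟫ + ⟪β, a.2⟫ :=
  inner_add_right _ _ _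

/-- No regularity of the best response in the type is needed, because types carry the discrete
σ-algebra. -/
lemma measurable_score (X : Set (Cov d)) (σ : ℝ) (β : Cov d) (s : ℝ) :
    Measurable (score X σ β s) := by
  have h1 : Measurable fun θ : AgentType d => ⟪β, bestResponse X σ θ β s⟫ := measurable_from_top
  have h2 : Measurable fun a : Agent d => ⟪β, bestResponse X σ a.1 β s⟫ := h1.comp measurable_fst
  have h3 : Measurable fun a : Agent d => ⟪β, a.2⟫ := by fun_prop
  rw [funext (score_eq X σ β s)]
  exact h2.add h3

lemma ae_fst_mem_support (p : PMF (AgentType d)) (σ : ℝ) :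
    ∀ᵐ a ∂(population p σ), a.1 ∈ p.support := by
  have h : ∀ᵐ θ ∂p.toMeasure, θ ∈ p.support := by
    rw [ae_iff, PMF.toMeasure_apply_eq_zero_iff p MeasurableSpace.measurableSet_top]
    exact Set.disjoint_left.2 fun θ h1 h2 => h2 h1
  exact Measure.quasiMeasurePreserving_fst.ae h

/-- Coupling the two score distributions through the same agents: if no response score moves by more
than `δ`, neither does the quantile. -/
lemma abs_meanFieldOp_sub_le {X : Set (Cov d)} {σ : ℝ} {p : PMF (AgentType d)} {q : ℝ}
    (hq0 : 0 < q) (hq1 : q < 1) {β : Cov d} {s s' δ : ℝ}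
    (h : ∀ θ ∈ p.support,
      |⟪β, bestResponse X σ θ β s⟫ - ⟪β, bestResponse X σ θ β s'⟫| ≤ δ) :
    |meanFieldOp X σ p q β s - meanFieldOp X σ p q β s'| ≤ δ := by
  have key : ∀ u u' : ℝ, (∀ θ ∈ p.support,
      ⟪β, bestResponse X σ θ β u'⟫ ≤ ⟪β, bestResponse X σ θ β u⟫ + δ) →
      ∀ r, scoreCDF X σ p β u r ≤ scoreCDF X σ p β u' (r + δ) := by
    intro u u' huu r
    have i1 := Measure.isProbabilityMeasure_map (μ := population p σ)
      (measurable_score X σ β u).aemeasurable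
    have i2 := Measure.isProbabilityMeasure_map (μ := population p σ)
      (measurable_score X σ β u').aemeasurable
    unfold scoreCDF
    rw [cdf_eq_real, cdf_eq_real, map_measureReal_apply (measurable_score X σ β u) measurableSet_Iic,
      map_measureReal_apply (measurable_score X σ β u') measurableSet_Iic]
    refine ENNReal.toReal_mono (measure_ne_top _ _) (measure_mono_ae ?_)
    filter_upwards [ae_fst_mem_support p σ] with a ha (hr : score X σ β u a ≤ r)
    change score X σ β u' a ≤ r + δ
    rw [score_eq] at hr ⊢
    linarith [huu a.1 ha]
  refine abs_quantile_sub_le (hasQuantile_cdf _ hq0 hq1) (hasQuantile_cdf _ hq0 hq1)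
    (key s s' fun θ hθ => ?_) (key s' s fun θ hθ => ?_)
  · linarith [(abs_sub_le_iff.1 (h θ hθ)).2]
  · linarith [(abs_sub_le_iff.1 (h θ hθ)).1]

lemma abs_empiricalOp_sub_le {X : Set (Cov d)} {σ : ℝ} {p : PMF (AgentType d)} {q : ℝ}
    (hq0 : 0 < q) (hq1 : q < 1) {β : Cov d} {s s' δ : ℝ}
    (h : ∀ θ ∈ p.support,
      |⟪β, bestResponse X σ θ β s⟫ - ⟪β, bestResponse X σ θ β s'⟫| ≤ δ)
    {n : ℕ} (hn : 0 < n) {a : Fin n → Agent d} (ha : ∀ i, (a i).1 ∈ p.support) :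
    |empiricalOp X σ q β a s - empiricalOp X σ q β a s'| ≤ δ := by
  refine abs_quantile_sub_le (hasQuantile_empiricalCDF hn _ hq0 hq1)
    (hasQuantile_empiricalCDF hn _ hq0 hq1) (empiricalCDF_le_of_le_add fun i => ?_)
    (empiricalCDF_le_of_le_add fun i => ?_) <;> rw [score_eq, score_eq]
  · linarith [(abs_sub_le_iff.1 (h _ (ha i))).2]
  · linarith [(abs_sub_le_iff.1 (h _ (ha i))).1]

lemma strictMono_scoreCDF (X : Set (Cov d)) {σ : ℝ} (hσ : 0 < σ) (p : PMF (AgentType d))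
    {β : Cov d} (hβ : ‖β‖ = 1) (s : ℝ) : StrictMono (scoreCDF X σ p β s) := by
  intro a b hab
  have hv : (σ ^ 2).toNNReal ≠ 0 := (Real.toNNReal_pos.2 (by positivity)).ne'
  have hprob := Measure.isProbabilityMeasure_map (μ := population p σ)
    (measurable_score X σ β s).aemeasurable
  set ν := (population p σ).map (score X σ β s) with hν
  have hpos : 0 < ν (Set.Ioc a b) := by
    obtain ⟨θ, hθ⟩ := p.support_nonempty
    set w := ⟪β, bestResponse X σ θ β s⟫
    have hsub : ({θ} : Set (AgentType d)) ×ˢ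
        ((fun ε : Cov d => ⟪β, ε⟫) ⁻¹' Set.Ioc (a - w) (b - w))
        ⊆ score X σ β s ⁻¹' Set.Ioc a b := by
      rintro ⟨θ', ε⟩ ⟨h1, h2⟩
      obtain rfl : θ' = θ := h1
      have h3 : a - w < ⟪β, ε⟫ := h2.1
      have h4 : ⟪β, ε⟫ ≤ b - w := h2.2
      have h5 : score X σ β s (θ', ε) = w + ⟪β, ε⟫ := score_eq _ _ _ _ _
      rw [Set.mem_preimage, h5]
      exact ⟨by linarith, by linarith⟩
    have hm : Measurable fun ε : Cov d => ⟪β, ε⟫ := by fun_prop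
    rw [hν, Measure.map_apply (measurable_score X σ β s) measurableSet_Ioc]
    refine lt_of_lt_of_le ?_ (measure_mono hsub)
    rw [population, Measure.prod_prod, ← Measure.map_apply hm measurableSet_Ioc,
      map_inner_noiseLaw σ hβ]
    refine ENNReal.mul_pos ?_ ?_
    · rw [PMF.toMeasure_apply_singleton _ _ MeasurableSpace.measurableSet_top]
      exact hθ
    · intro h0
      have h1 := gaussianReal_absolutelyContinuous' 0 hv h0
      rw [Real.volume_Ioc, ENNReal.ofReal_eq_zero] at h1
      linarith
  rw [← measure_cdf ν, StieltjesFunction.measure_Ioc, ENNReal.ofReal_pos, sub_pos] at hpos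
  exact hpos

/-! ### Concentration of empirical quantiles -/

variable {Ω : Type*} [MeasurableSpace Ω] {μ : Measure Ω} [IsProbabilityMeasure μ]

/-- Hoeffding's inequality for the empirical frequency of `B`, multiplied by the sample size. -/
lemma measureReal_le_sum_indicator_le {ν : Measure ℝ} [IsProbabilityMeasure ν] {n : ℕ}
    (hn : 0 < n) {Y : Fin n → Ω → ℝ} (hY : ∀ i, HasLaw (Y i) ν μ) (hindep : iIndepFun Y μ)
    {B : Set ℝ} (hB : MeasurableSet B) {η : ℝ} (hη : 0 ≤ η) :
    μ.real {ω | n * (ν.real B + η) ≤ ∑ i, B.indicator (fun _ => (1 : ℝ)) (Y i ω)}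
      ≤ Real.exp (-2 * n * η ^ 2) := by
  have hn' : (0 : ℝ) < n := by exact_mod_cast hn
  have hind : Measurable (B.indicator fun _ => (1 : ℝ)) := measurable_const.indicator hB
  have hmean : ∀ i, ∫ ω, B.indicator (fun _ => (1 : ℝ)) (Y i ω) ∂μ = ν.real B := by
    intro i
    rw [← integral_map (hY i).aemeasurable hind.aestronglyMeasurable, (hY i).map_eq]
    exact integral_indicator_one hB
  have hsub : ∀ i ∈ Finset.univ, HasSubgaussianMGF
      (fun ω => B.indicator (fun _ => (1 : ℝ)) (Y i ω) - ν.real B) ((‖(1 : ℝ) - 0‖₊ / 2) ^ 2) μ := by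
    intro i _
    have := hasSubgaussianMGF_of_mem_Icc (μ := μ) (a := 0) (b := 1)
      (X := fun ω => B.indicator (fun _ => (1 : ℝ)) (Y i ω))
      (hind.comp_aemeasurable (hY i).aemeasurable) (ae_of_all _ fun ω => by
        by_cases h : Y i ω ∈ B <;> simp [h])
    rwa [hmean i] at this
  have hoeff := HasSubgaussianMGF.measure_sum_ge_le_of_iIndepFun
    (hindep.comp (fun _ y => B.indicator (fun _ => (1 : ℝ)) y - ν.real B)
      fun _ => hind.sub_const _) hsub (ε := n * η) (by positivity)
  convert hoeff using 2
  · ext ω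
    simp only [Set.mem_ofPred_eq, Function.comp, Finset.sum_sub_distrib, Finset.sum_const,
      Finset.card_univ, Fintype.card_fin, nsmul_eq_mul, le_sub_iff_add_le]
    rw [mul_add, add_comm]
  · simp
    field_simp

/-- Hoeffding's inequality on the two sides of the population quantile. Strict monotonicity of the
distribution function makes both deviations cost a positive amount `η` of probability mass. -/
lemma exists_measureReal_quantile_le (μ : Measure Ω) [IsProbabilityMeasure μ] {ν : Measure ℝ}
    [IsProbabilityMeasure ν] (hν : StrictMono (cdf ν)) {q : ℝ} (hq0 : 0 < q) (hq1 : q < 1)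
    {δ : ℝ} (hδ : 0 < δ) :
    ∃ η > 0, ∀ n : ℕ, 0 < n → ∀ Y : Fin n → Ω → ℝ, (∀ i, HasLaw (Y i) ν μ) → iIndepFun Y μ →
      μ.real {ω | δ < |quantile (empiricalCDF fun i => Y i ω) q - quantile (cdf ν) q|}
        ≤ 2 * Real.exp (-2 * n * η ^ 2) := by
  obtain ⟨hne, hbdd⟩ := hasQuantile_cdf ν hq0 hq1
  set T := quantile (cdf ν) q with hT
  have hup : q < cdf ν (T + δ) := by
    obtain ⟨r, hr, hrT⟩ := exists_lt_of_csInf_lt hne (show T < T + δ by linarith)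
    exact lt_of_le_of_lt hr (hν hrT)
  have hlo : cdf ν (T - δ) < q := by
    by_contra! h
    have : T ≤ T - δ := csInf_le hbdd h
    linarith
  refine ⟨min (cdf ν (T + δ) - q) (q - cdf ν (T - δ)), lt_min (by linarith) (by linarith), ?_⟩
  set η := min (cdf ν (T + δ) - q) (q - cdf ν (T - δ)) with hη
  have hη0 : 0 < η := lt_min (by linarith) (by linarith)
  have hη1 : η ≤ cdf ν (T + δ) - q := min_le_left _ _
  have hη2 : η ≤ q - cdf ν (T - δ) := min_le_right _ _
  intro n hn Y hY hindep
  have hn' : (0 : ℝ) < n := by exact_mod_cast hn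
  have b1 := measureReal_le_sum_indicator_le hn hY hindep
    (measurableSet_Ioi (a := T + δ)) hη0.le
  have b2 := measureReal_le_sum_indicator_le hn hY hindep
    (measurableSet_Iic (a := T - δ)) hη0.le
  have hIoi : ν.real (Set.Ioi (T + δ)) = 1 - cdf ν (T + δ) := by
    rw [cdf_eq_real, ← Set.compl_Iic, probReal_compl_eq_one_sub measurableSet_Iic]
  rw [hIoi] at b1
  rw [← cdf_eq_real] at b2
  have hcard : ∀ (r : ℝ) ω, ∑ i, (Set.Iic r).indicator (fun _ => (1 : ℝ)) (Y i ω)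
      = n * empiricalCDF (fun i => Y i ω) r := by
    intro r ω
    rw [empiricalCDF, mul_div_cancel₀ _ hn'.ne', Finset.card_filter]
    push_cast
    simp [Set.indicator_apply]
  have hcard' : ∀ (r : ℝ) ω, ∑ i, (Set.Ioi r).indicator (fun _ => (1 : ℝ)) (Y i ω)
      = n * (1 - empiricalCDF (fun i => Y i ω) r) := by
    intro r ω
    have hsplit : ∀ y : ℝ, (Set.Ioi r).indicator (fun _ => (1 : ℝ)) y
        = 1 - (Set.Iic r).indicator (fun _ => (1 : ℝ)) y := by
      intro y
      rcases le_or_gt y r with h | h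
      · simp [h, h.not_gt]
      · simp [h, h.not_ge]
    simp_rw [mul_sub, ← hcard, hsplit]
    simp
  refine (measureReal_mono ?_ (measure_ne_top _ _)).trans
    ((measureReal_union_le _ _).trans ((add_le_add b1 b2).trans (two_mul _).ge))
  intro ω hω
  obtain ⟨hne', hbdd'⟩ := hasQuantile_empiricalCDF hn (fun i => Y i ω) hq0 hq1
  rw [Set.mem_ofPred_eq] at hω
  rcases lt_abs.1 hω with h | h
  · left
    have : empiricalCDF (fun i => Y i ω) (T + δ) < q :=
      not_le.1 fun hle => by
        have : quantile (empiricalCDF fun i => Y i ω) q ≤ T + δ := csInf_le hbdd' hle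
        linarith
    rw [Set.mem_ofPred_eq, hcard']
    gcongr
    linarith
  · right
    obtain ⟨r, hr, hrT⟩ := exists_lt_of_csInf_lt hne'
      (show quantile (empiricalCDF fun i => Y i ω) q < T - δ by linarith)
    have := empiricalCDF_mono (fun i => Y i ω) hrT.le
    rw [Set.mem_ofPred_eq, hcard]
    gcongr
    have hr' : q ≤ empiricalCDF (fun i => Y i ω) r := hr
    linarith

/-! ### Contraction and convergence -/

lemma abs_sub_le_of_perturbed_contraction {S : ℕ → ℝ} {c k δ : ℝ} (hk0 : 0 ≤ k) (hk1 : k < 1)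
    (hδ : 0 ≤ δ) (t m : ℕ) (h : ∀ j < m, |S (t + j + 1) - c| ≤ k * |S (t + j) - c| + δ) :
    |S (t + m) - c| ≤ k ^ m * |S t - c| + δ / (1 - k) := by
  have hk : 0 < 1 - k := by linarith
  induction m with
  | zero =>
    have : 0 ≤ δ / (1 - k) := by positivity
    simpa using this
  | succ m ih =>
    have h1 := ih fun j hj => h j (by omega)
    calc |S (t + (m + 1)) - c| ≤ k * |S (t + m) - c| + δ := h m (by omega)
      _ ≤ k * (k ^ m * |S t - c| + δ / (1 - k)) + δ := by gcongr
      _ = k ^ (m + 1) * |S t - c| + δ / (1 - k) := by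
        field_simp
        ring

lemma existsUnique_fixedPoint_of_abs_sub_le {T : ℝ → ℝ} {k : ℝ} (hk0 : 0 ≤ k) (hk1 : k < 1)
    (hT : ∀ s s', |T s - T s'| ≤ k * |s - s'|) : ∃ c, ∀ s, T s = s ↔ s = c := by
  have hc : ContractingWith ⟨k, hk0⟩ T :=
    ⟨by exact_mod_cast hk1, LipschitzWith.of_dist_le_mul fun s s' => hT s s'⟩
  exact ⟨hc.fixedPoint, fun s => ⟨fun h => hc.fixedPoint_unique h,
    fun h => h ▸ hc.fixedPoint_isFixedPt⟩⟩

/-- The threshold dynamics converge in probability as soon as all response scores contract at a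
common rate `k < 1` and are bounded. The empirical operators are then themselves `k`-Lipschitz along
almost every sample, so the only random input is their error at the fixed threshold `c`, and only
the last few steps before time `t n` matter. -/
lemma tendstoInMeasure_thresholdProcess {X : Set (Cov d)} {q : ℝ} (hq0 : 0 < q) (hq1 : q < 1)
    {σ : ℝ} (hσ : 0 < σ) {β : Cov d} (hβ : ‖β‖ = 1) {p : PMF (AgentType d)} {k M : ℝ}
    (hk0 : 0 ≤ k) (hk1 : k < 1)
    (hlip : ∀ θ ∈ p.support, ∀ s s', |⟪β, bestResponse X σ θ β s⟫ -
      ⟪β, bestResponse X σ θ β s'⟫| ≤ k * |s - s'|)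
    (hM : ∀ θ ∈ p.support, ∀ s s', |⟪β, bestResponse X σ θ β s⟫ -
      ⟪β, bestResponse X σ θ β s'⟫| ≤ M)
    {c : ℝ} (hc : meanFieldOp X σ p q β c = c)
    {A : (n : ℕ) → ℕ → Fin n → Ω → Agent d}
    (hlaw : ∀ n t i, HasLaw (A n t i) (population p σ) μ)
    (hindep : ∀ n t, iIndepFun (A n t) μ) (S₀ : ℕ → Ω → ℝ)
    {t : ℕ → ℕ} (ht : Tendsto t atTop atTop) :
    TendstoInMeasure μ
      (fun n ω => thresholdProcess X σ q β (fun k i => A n k i ω) (S₀ n ω) (t n))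
      atTop (fun _ => c) := by
  rw [tendstoInMeasure_iff_measureReal_dist]
  intro ε hε
  have hk : 0 < 1 - k := by linarith
  set δ := ε * (1 - k) / 3 with hδ
  have hδ0 : 0 < δ := by positivity
  have hδε : δ / (1 - k) = ε / 3 := by rw [hδ]; field_simp
  obtain ⟨m, hm⟩ : ∃ m : ℕ, k ^ m * (M + δ) < ε / 3 := by
    have := (tendsto_pow_atTop_nhds_zero_of_lt_one hk0 hk1).mul_const (M + δ)
    rw [zero_mul] at this
    exact (this.eventually (gt_mem_nhds (by positivity))).exists
  have hprob := Measure.isProbabilityMeasure_map (μ := population p σ)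
    (measurable_score X σ β c).aemeasurable
  obtain ⟨η, hη, hconc⟩ := exists_measureReal_quantile_le μ
    (ν := (population p σ).map (score X σ β c)) (strictMono_scoreCDF X hσ p hβ c) hq0 hq1 hδ0
  change ∀ n : ℕ, 0 < n → ∀ Y : Fin n → Ω → ℝ, _ → _ →
    μ.real {ω | δ < |quantile (empiricalCDF fun i => Y i ω) q - meanFieldOp X σ p q β c|} ≤ _
    at hconc
  rw [hc] at hconc
  have hbad : ∀ n, 0 < n → ∀ u,
      μ.real {ω | δ < |empiricalOp X σ q β (fun i => A n u i ω) c - c|}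
        ≤ 2 * Real.exp (-2 * n * η ^ 2) := fun n hn u =>
    hconc n hn (fun i ω => score X σ β c (A n u i ω))
      (fun i => (MeasurePreserving.mk (measurable_score X σ β c) rfl).hasLaw.comp (hlaw n u i))
      ((hindep n u).comp (fun _ => score X σ β c) fun _ => measurable_score X σ β c)
  have hlim : Tendsto (fun n : ℕ => ((m + 1 : ℕ) : ℝ) * (2 * Real.exp (-2 * n * η ^ 2)))
      atTop (𝓝 0) := by
    have h1 : Tendsto (fun n : ℕ => -2 * (n : ℝ) * η ^ 2) atTop atBot := by
      have : Tendsto (fun n : ℕ => (2 * η ^ 2) * (n : ℝ)) atTop atTop :=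
        tendsto_natCast_atTop_atTop.const_mul_atTop (by positivity)
      refine (tendsto_neg_atTop_atBot.comp this).congr fun n => ?_
      simp only [Function.comp]
      ring
    simpa using ((Real.tendsto_exp_atBot.comp h1).const_mul 2).const_mul ((m + 1 : ℕ) : ℝ)
  refine squeeze_zero' (Eventually.of_forall fun n => measureReal_nonneg) ?_ hlim
  filter_upwards [eventually_gt_atTop 0, ht.eventually_ge_atTop (m + 1)] with n hn htn
  obtain ⟨u, hu⟩ : ∃ u, t n = u + 1 + m := ⟨t n - (m + 1), by omega⟩
  have hsupp : ∀ᵐ ω ∂μ, ∀ v i, (A n v i ω).1 ∈ p.support := by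
    simp only [ae_all_iff]
    intro v i
    have := ae_fst_mem_support p σ
    rw [← (hlaw n v i).map_eq] at this
    exact ae_of_ae_map (hlaw n v i).aemeasurable this
  have hcover : μ.real {ω | ε ≤ dist (thresholdProcess X σ q β (fun k i => A n k i ω) (S₀ n ω)
        (t n)) c}
      ≤ μ.real (⋃ j ∈ Finset.range (m + 1),
        {ω | δ < |empiricalOp X σ q β (fun i => A n (u + j) i ω) c - c|}) := by
    refine ENNReal.toReal_mono (measure_ne_top _ _) (measure_mono_ae ?_)
    filter_upwards [hsupp] with ω hω
    change ε ≤ _ → ω ∈ (⋃ j ∈ Finset.range (m + 1), _ : Set Ω)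
    contrapose!
    intro hgood
    simp only [Set.mem_iUnion, Finset.mem_range, not_exists, Set.mem_ofPred_eq, not_lt] at hgood
    set S := thresholdProcess X σ q β (fun k i => A n k i ω) (S₀ n ω) with hS
    have hstep : ∀ v, S (v + 1) = empiricalOp X σ q β (fun i => A n v i ω) (S v) := fun v => rfl
    have hstart : |S (u + 1) - c| ≤ M + δ := by
      rw [hstep]
      have h1 := abs_empiricalOp_sub_le (s := S u) (s' := c) hq0 hq1
        (fun θ hθ => hM θ hθ (S u) c) hn (hω u)
      have h2 := hgood 0 (by omega)
      rw [add_zero] at h2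
      exact (abs_sub_le _ _ _).trans (add_le_add h1 h2)
    have hrun := abs_sub_le_of_perturbed_contraction (S := S) (c := c) hk0 hk1 hδ0.le (u + 1) m
      (fun j hj => by
        rw [hstep]
        have h1 := abs_empiricalOp_sub_le (s := S (u + 1 + j)) (s' := c) hq0 hq1
          (fun θ hθ => hlip θ hθ (S (u + 1 + j)) c) hn (hω (u + 1 + j))
        have h2 := hgood (j + 1) (by omega)
        rw [show u + (j + 1) = u + 1 + j by ring] at h2
        exact (abs_sub_le _ _ _).trans (add_le_add h1 h2))
    rw [hu, Real.dist_eq]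
    calc |S (u + 1 + m) - c| ≤ k ^ m * |S (u + 1) - c| + δ / (1 - k) := hrun
      _ ≤ k ^ m * (M + δ) + δ / (1 - k) := by gcongr
      _ < ε := by rw [hδε]; linarith
  refine hcover.trans ((measureReal_biUnion_finset_le _ _).trans ?_)
  refine (Finset.sum_le_sum fun j _ => hbad n hn (u + j)).trans ?_
  simp

/-- With finitely many types, the noise condition makes every strong convexity constant exceed twice
the largest slope of the noise density, uniformly over the types. -/
lemma two_mul_gaussianSlope_lt_alphaStar {p : PMF (AgentType d)} (hfin : p.support.Finite)
    {α : AgentType d → ℝ} (hα : ∀ θ ∈ p.support, 0 < α θ) {σ : ℝ} (hσ : 0 < σ)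
    (hnoise : 2 / (alphaStar p α * √(2 * Real.pi * Real.exp 1)) < σ ^ 2) :
    2 * gaussianSlope (σ ^ 2).toNNReal < alphaStar p α ∧
      ∀ θ ∈ p.support, alphaStar p α ≤ α θ := by
  have hfin' := hfin.image α
  have hpos : 0 < alphaStar p α := by
    obtain ⟨θ, hθ, h⟩ := (p.support_nonempty.image α).csInf_mem hfin'
    rw [alphaStar, ← h]
    exact hα θ hθ
  refine ⟨?_, fun θ hθ => csInf_le hfin'.bddBelow ⟨θ, hθ, rfl⟩⟩
  have hC : 0 < √(2 * Real.pi * Real.exp 1) := Real.sqrt_pos.2 (by positivity)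
  rw [div_lt_iff₀ (by positivity)] at hnoise
  rw [gaussianSlope, Real.coe_toNNReal _ (by positivity), mul_one_div,
    div_lt_iff₀ (by positivity)]
  linarith

end StrategicThreshold

open StrategicThreshold in
theorem corollary1 {d : ℕ}
    -- covariate set
    (X : Set (StrategicThreshold.Cov d)) (hXconv : Convex ℝ X) (hXcomp : IsCompact X)
    -- capacity level, noise level, selection criterion
    (q : ℝ) (hq0 : 0 < q) (hq1 : q < 1)
    (σ : ℝ) (hσ : 0 < σ)
    (β : StrategicThreshold.Cov d) (hβ : β ∈ Metric.sphere (0 : StrategicThreshold.Cov d) 1)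
    -- law of the agent types, with finite support and raw covariates in `X`
    (p : PMF (StrategicThreshold.AgentType d)) (hfin : p.support.Finite)
    (hraw : ∀ θ ∈ p.support, θ.raw ∈ X)
    -- regular cost functions with strong convexity constants `α θ`
    (α : StrategicThreshold.AgentType d → ℝ)
    (hcost : ∀ θ ∈ p.support, StrategicThreshold.IsRegularCost θ.cost (α θ))
    -- interior best responses
    (hint : ∀ θ ∈ p.support, ∀ s : ℝ,
      StrategicThreshold.bestResponse X σ θ β s ∈ interior X)
    -- noise condition
    (hnoise : 2 / (StrategicThreshold.alphaStar p α * √(2 * Real.pi * Real.exp 1)) < σ ^ 2)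
    -- for every `n`, fresh i.i.d. agents at every time step and an independent initial threshold
    {Ω : Type*} [MeasurableSpace Ω] (μ : Measure Ω) [IsProbabilityMeasure μ]
    (A : (n : ℕ) → ℕ → Fin n → Ω → StrategicThreshold.Agent d)
    (hlaw : ∀ n t i, HasLaw (A n t i) (StrategicThreshold.population p σ) μ)
    (hindep : ∀ n, iIndepFun (fun k : ℕ × Fin n => A n k.1 k.2) μ)
    (S₀ : ℕ → Ω → ℝ) (hS₀ : ∀ n, AEMeasurable (S₀ n) μ)
    (hS₀indep : ∀ n, IndepFun (S₀ n) (fun ω (k : ℕ × Fin n) => A n k.1 k.2 ω) μ)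
    -- times that tend to infinity slower than exponentially
    (t : ℕ → ℕ) (ht : Tendsto t atTop atTop)
    (htexp : (fun n => (t n : ℝ)) =o[atTop] fun n : ℕ => Real.exp n) :
    ∃ sβ : ℝ,
      (∀ s : ℝ, StrategicThreshold.meanFieldOp X σ p q β s = s ↔ s = sβ) ∧
      TendstoInMeasure μ
        (fun n ω => StrategicThreshold.thresholdProcess X σ q β (fun k i => A n k i ω)
          (S₀ n ω) (t n))
        atTop (fun _ => sβ) := by
  have hβ' : ‖β‖ = 1 := mem_sphere_zero_iff_norm.1 hβ
  obtain ⟨hα, hαle⟩ := two_mul_gaussianSlope_lt_alphaStar hfin (fun θ hθ => (hcost θ hθ).pos) hσ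
    hnoise
  have hL := gaussianSlope_pos (v := (σ ^ 2).toNNReal) (Real.toNNReal_pos.2 (by positivity)).ne'
  set L := gaussianSlope (σ ^ 2).toNNReal
  set k := L / (alphaStar p α - L) with hk
  have hk0 : 0 ≤ k := div_nonneg hL.le (by linarith)
  have hk1 : k < 1 := by rw [hk, div_lt_one (by linarith)]; linarith
  have hne : X.Nonempty := by
    obtain ⟨θ, hθ⟩ := p.support_nonempty
    exact ⟨_, hraw θ hθ⟩
  have hbest : ∀ θ ∈ p.support, ∀ s, IsBestResponse X σ θ β s (bestResponse X σ θ β s) :=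
    fun θ hθ s => isBestResponse_bestResponse hXcomp hne hσ (hcost θ hθ).contDiff.continuous hβ' s
  have hlip : ∀ θ ∈ p.support, ∀ s s', |⟪β, bestResponse X σ θ β s⟫ -
      ⟪β, bestResponse X σ θ β s'⟫| ≤ k * |s - s'| := by
    intro θ hθ s s'
    have hαθ := hαle θ hθ
    refine ((hbest θ hθ s).abs_inner_sub_le hXconv hσ (hcost θ hθ).strongConvex (by linarith) hβ'
      (hbest θ hθ s')).trans ?_
    rw [hk]
    gcongr
    linarith
  have hM : ∀ θ ∈ p.support, ∀ s s', |⟪β, bestResponse X σ θ β s⟫ -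
      ⟪β, bestResponse X σ θ β s'⟫| ≤ Metric.diam X := by
    intro θ hθ s s'
    rw [← inner_sub_right]
    refine (abs_real_inner_le_norm _ _).trans ?_
    rw [hβ', one_mul, ← dist_eq_norm]
    exact Metric.dist_le_diam_of_mem hXcomp.isBounded (hbest θ hθ s).1 (hbest θ hθ s').1
  obtain ⟨c, hc⟩ := existsUnique_fixedPoint_of_abs_sub_le hk0 hk1 fun s s' =>
    abs_meanFieldOp_sub_le (X := X) (σ := σ) (p := p) (β := β) hq0 hq1 fun θ hθ => hlip θ hθ s s'
  refine ⟨c, hc, ?_⟩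
  exact tendstoInMeasure_thresholdProcess hq0 hq1 hσ hβ' hk0 hk1 hlip hM ((hc c).2 rfl) hlaw
    (fun n u => (hindep n).precomp (g := fun i => (u, i)) fun i j h => (Prod.mk.inj h).2) S₀ ht
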